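/- Let $\alpha,\beta,\gamma,\delta\in\mathbb{C}$ with $\beta\notin\{-1,-2,-3,\dots\}$, put $$\eta_0=(1+\beta)\frac{\alpha}{2}-(1+\gamma)\frac{\beta}{2}-\frac{\gamma}{2},\qquad K(x)=\alpha x^2+(2+\beta+\gamma-\alpha)x-\beta-1,$$ and let $\Omega\neq 0$ be a square root of $2\alpha(\beta+\gamma+2)+4\delta$; set $z(x)=\Omega\sqrt{x-1}$. For a parameter $\eta$ the confluent Heun equation is $$y''+\Big(\alpha+\frac{1+\beta}{x}+\frac{1+\gamma}{x-1}\Big)y'+\frac{[(\beta+\gamma+2)\alpha+2\delta]x-(\beta+1)\alpha+(\gamma+1)\beta+2\eta+\gamma}{2x(x-1)}\,y=0 .$$ The power series $H_c(x)=H_c(\alpha,\beta,\gamma,\delta,\eta_0;x)$ at $0$ determined by this equation with $\eta=\eta_0$ and $H_c(0)=1$ is analytic in the disc $|x|<1$, solves the equation there, and satisfies $H_c'(0)=\frac{(1+\gamma-\alpha)\beta+\gamma-\alpha+2\eta_0}{2(1+\beta)}$. Moreover, let $H_c$ also denote any single-valued analytic continuation of this function to an open connected set $U\subseteq\mathbb{C}$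 containing $0$ (for instance, the unit disc). Then on every real open interval $I\subseteq U\setminus\{0,1\}$ $$\int x^{\beta}(x-1)^{\gamma}e^{\alpha x}K(x)\,J_0(z(x))\,H_c(x)\,dx = x^{1+\beta}(x-1)^{1+\gamma}e^{\alpha x}\Big[J_0(z(x))H_c(x)-\frac{2}{\Omega}\sqrt{x-1}\,J_1(z(x))\,H_c'(x)\Big]+c,$$ $$\int x^{\beta}(x-1)^{\gamma}e^{\alpha x}K(x)\,Y_0(z(x))\,H_c(x)\,dx = x^{1+\beta}(x-1)^{1+\gamma}e^{\alpha x}\Big[Y_0(z(x))H_c(x)-\frac{2}{\Omega}\sqrt{x-1}\,Y_1(z(x))\,H_c'(x)\Big]+c .$$ That is, the antiderivatives on $I$ of the integrand on the left are exactly the functions on the right, with $c\in\mathbb{C}$ an arbitrary constant. Here $J_n,Y_n$ are the Bessel functions of the first and second kind, and powers, square roots of $x-1$ and the logarithm in $Y_n$ take their principal values. -/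

import Mathlib

noncomputable section

/-- Coefficient of the first derivative in the confluent Heun equation
`y'' + p y' + q y = 0`. -/
def heunP (α β γ : ℂ) (x : ℂ) : ℂ :=
  α + (1 + β) / x + (1 + γ) / (x - 1)

/-- Coefficient of the unknown in the confluent Heun equation `y'' + p y' + q y = 0`. -/
def heunQ (α β γ δ η : ℂ) (x : ℂ) : ℂ :=
  (((β + γ + 2) * α + 2 * δ) * x - (β + 1) * α + (γ + 1) * β + 2 * η + γ) / (2 * x * (x - 1))

/-- Taylor coefficients at `0` of the local solution of the confluent Heun equation that is
analytic at `0` and takes the value `1` there. They are obtained by inserting a power series in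
the equation multiplied by `x (x - 1)`; the recurrence determines them as long as `β` is not a
negative integer. -/
def heunCoeff (α β γ δ η : ℂ) : ℕ → ℂ
  | 0 => 1
  | 1 => ((1 + γ - α) * β + γ - α + 2 * η) / (2 * (1 + β))
  | n + 2 =>
      ((((n : ℂ) + 1) * ((n : ℂ) + 2 + β + γ - α)
            + ((1 + γ - α) * β + γ - α + 2 * η) / 2) * heunCoeff α β γ δ η (n + 1)
          + (α * (n : ℂ) + ((β + γ + 2) * α + 2 * δ) / 2) * heunCoeff α β γ δ η n)
        / (((n : ℂ) + 2) * ((n : ℂ) + 2 + β))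

/-- The confluent Heun function `H_c(α, β, γ, δ, η; x)` on the unit disc: the local solution of
the confluent Heun equation at `0`, as a power series. -/
def heunC (α β γ δ η : ℂ) (x : ℂ) : ℂ :=
  ∑' n : ℕ, heunCoeff α β γ δ η n * x ^ n

/-- `H` is a (single-valued) analytic continuation of `H_c(α, β, γ, δ, η; ·)` to the complex
domain `U`, which contains the origin. -/
structure IsHeunCContinuation (α β γ δ η : ℂ) (U : Set ℂ) (H : ℂ → ℂ) : Prop where
  isOpen : IsOpen U
  isPreconnected : IsPreconnected U
  zero_mem : (0 : ℂ) ∈ U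
  analytic : DifferentiableOn ℂ H U
  germ : H =ᶠ[nhds 0] heunC α β γ δ η

/-- The Bessel function of the first kind `J_n`, of order `n ∈ ℕ`. -/
def besselJ (n : ℕ) (z : ℂ) : ℂ :=
  ∑' k : ℕ, (-1) ^ k / ((k.factorial : ℂ) * ((n + k).factorial : ℂ)) * (z / 2) ^ (2 * k + n)

/-- The digamma value `ψ(m + 1) = -γ + ∑_{j = 1}^m 1 / j`, where `γ` is Euler's constant. -/
def psiSucc (m : ℕ) : ℂ :=
  ((harmonic m : ℚ) : ℂ) - (Real.eulerMascheroniConstant : ℂ)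

/-- The Bessel function of the second kind `Y_n`, of order `n ∈ ℕ`, with the principal branch of
the logarithm (and without meaning at `z = 0`). -/
def besselY (n : ℕ) (z : ℂ) : ℂ :=
  2 / (Real.pi : ℂ) * Complex.log (z / 2) * besselJ n z
    - 1 / (Real.pi : ℂ) * (∑ k ∈ Finset.range n,
        ((n - k - 1).factorial : ℂ) / (k.factorial : ℂ) * (z / 2) ^ (2 * (k : ℤ) - (n : ℤ)))
    - 1 / (Real.pi : ℂ) * ∑' k : ℕ,
        (-1) ^ k * (psiSucc k + psiSucc (n + k)) / ((k.factorial : ℂ) * ((n + k).factorial : ℂ))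
          * (z / 2) ^ (2 * k + n)

/-- `∫ f(x) dx = F(x) + c` on the real interval `I`: the antiderivatives of `f` on `I` are
exactly the functions that agree there with `F + c` for some constant `c`. -/
def IsIndefiniteIntegralOn (I : Set ℝ) (f F : ℝ → ℂ) : Prop :=
  ∀ G : ℝ → ℂ, (∀ x ∈ I, HasDerivAt G (f x) x) ↔ ∃ c : ℂ, ∀ x ∈ I, G x = F x + c

/-- The value `η₀` of the parameter `η`. -/
def heunEta0 (α β γ : ℂ) : ℂ :=
  (1 + β) * (α / 2) - (1 + γ) * (β / 2) - γ / 2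

/-- The polynomial `K`. -/
def heunK (α β γ : ℂ) (x : ℂ) : ℂ :=
  α * x ^ 2 + (2 + β + γ - α) * x - β - 1

/-- The principal square root `√(x - 1)`. -/
def sqrtSubOne (x : ℝ) : ℂ :=
  ((x : ℂ) - 1) ^ (1 / 2 : ℂ)

/-- The integrand `x^β (x-1)^γ e^{αx} K(x) B₀(z(x)) H(x)` with `z(x) = Ω √(x - 1)`. -/
def heunBesselIntegrand (α β γ Ω : ℂ) (B₀ H : ℂ → ℂ) (x : ℝ) : ℂ :=
  (x : ℂ) ^ β * ((x : ℂ) - 1) ^ γ * Complex.exp (α * x) * heunK α β γ x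
    * B₀ (Ω * sqrtSubOne x) * H x

/-- The function `x^{1+β} (x-1)^{1+γ} e^{αx} [B₀(z(x)) H(x) - (2/Ω) √(x-1) B₁(z(x)) H'(x)]`
with `z(x) = Ω √(x - 1)`. -/
def heunBesselPrimitive (α β γ Ω : ℂ) (B₀ B₁ H : ℂ → ℂ) (x : ℝ) : ℂ :=
  (x : ℂ) ^ (1 + β) * ((x : ℂ) - 1) ^ (1 + γ) * Complex.exp (α * x)
    * (B₀ (Ω * sqrtSubOne x) * H x
        - 2 / Ω * sqrtSubOne x * B₁ (Ω * sqrtSubOne x) * deriv H x)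

end

open Filter Topology

/-! Write W = x^(1+β) (x-1)^(1+γ) e^(αx). Then W' = pW for the coefficient p of y', and K is exactly
the polynomial for which W' = x^β (x-1)^γ e^(αx) K. At η = η₀ the constant term in the numerator of
the other coefficient q vanishes, leaving q = (Ω²/4)/(x-1). Put u = B₀(z) and v = (2/Ω)√(x-1) B₁(z).
The Bessel relations B₀' = -B₁ and (zB₁)' = zB₀ become u' = -qv and v' = u. Hence (W(uH - vH'))' =
W'uH - Wv(H'' + pH' + qH), and the last bracket is zero. This cancellation is
`hasDerivAt_heunBesselPrimitive`. Two inputs remain. The Heun equation is checked on coefficients in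
the unit disc (`heunOperator_heunC`) and carried to U by the identity theorem. The Bessel system is
checked on power series in w = (z/2)² (`isBesselPairAlong_besselJ`, `isBesselPairAlong_besselY`);
for Y the logarithm also has to be differentiated along the real line. -/

/-! ### Power series with geometrically bounded coefficients -/

/-- The sum of the power series with coefficients `c`. -/
noncomputable def powerSum (c : ℕ → ℂ) (z : ℂ) : ℂ := ∑' n : ℕ, c n * z ^ n

/-- The power series with coefficients `c` has radius of convergence at least `R`. -/
def GeomBounded (R : ℝ) (c : ℕ → ℂ) : Prop :=
  ∀ r : ℝ, 0 < r → r < R → ∃ C : ℝ, ∀ n, ‖c n‖ * r ^ n ≤ C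

/-- Coefficients of the termwise derivative. -/
def derivCoeff (c : ℕ → ℂ) (n : ℕ) : ℂ := ((n : ℂ) + 1) * c (n + 1)

/-- Coefficients of the series multiplied by the variable. -/
def shiftCoeff (c : ℕ → ℂ) : ℕ → ℂ
  | 0 => 0
  | n + 1 => c n

/-- The factor n + 1 is absorbed by moving to a radius s with r < s < R, since n (r/s)^n is bounded.
-/
theorem GeomBounded.derivCoeff {R : ℝ} {c : ℕ → ℂ} (h : GeomBounded R c) :
    GeomBounded R (derivCoeff c) := by
  intro r hr hrR
  obtain ⟨s, hrs, hsR⟩ := exists_between hrR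
  have hs : 0 < s := hr.trans hrs
  obtain ⟨C, hC⟩ := h s hs hsR
  have hq0 : 0 ≤ r / s := by positivity
  have hq1 : r / s < 1 := (div_lt_one hs).2 hrs
  have ht := tendsto_self_mul_const_pow_of_lt_one hq0 hq1
  obtain ⟨D, hD⟩ := ht.bddAbove_range
  refine ⟨C * D / r, fun n => ?_⟩
  have h1 := hC (n + 1)
  have h2 : ((n + 1 : ℕ) : ℝ) * (r / s) ^ (n + 1) ≤ D := hD ⟨n + 1, rfl⟩
  have hnorm : ‖_root_.derivCoeff c n‖ = ((n + 1 : ℕ) : ℝ) * ‖c (n + 1)‖ := by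
    rw [_root_.derivCoeff, norm_mul, ← Nat.cast_succ, Complex.norm_natCast]
  rw [le_div_iff₀ hr, hnorm]
  calc ((n + 1 : ℕ) : ℝ) * ‖c (n + 1)‖ * r ^ n * r
      = (‖c (n + 1)‖ * s ^ (n + 1)) * (((n + 1 : ℕ) : ℝ) * (r / s) ^ (n + 1)) := by
        rw [div_pow]; field_simp; ring
    _ ≤ C * D := by
        apply mul_le_mul h1 h2 (by positivity)
        exact le_trans (by positivity) h1

theorem GeomBounded.shiftCoeff {R : ℝ} {c : ℕ → ℂ} (h : GeomBounded R c) :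
    GeomBounded R (shiftCoeff c) := by
  intro r hr hrR
  obtain ⟨C, hC⟩ := h r hr hrR
  have hC0 : 0 ≤ C := le_trans (by positivity) (hC 0)
  refine ⟨C * r, fun n => ?_⟩
  cases n with
  | zero => simpa [_root_.shiftCoeff] using mul_nonneg hC0 hr.le
  | succ n =>
    simp only [_root_.shiftCoeff, pow_succ, ← mul_assoc]
    exact mul_le_mul_of_nonneg_right (hC n) hr.le

theorem GeomBounded.summable_norm {R : ℝ} {c : ℕ → ℂ} (h : GeomBounded R c) {r : ℝ}
    (hr0 : 0 ≤ r) (hr : r < R) : Summable fun n => ‖c n‖ * r ^ n := by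
  obtain ⟨s, hrs, hsR⟩ := exists_between hr
  have hs : 0 < s := hr0.trans_lt hrs
  obtain ⟨C, hC⟩ := h s hs hsR
  refine Summable.of_nonneg_of_le (fun n => by positivity) (fun n => ?_)
    ((summable_geometric_of_lt_one (by positivity) ((div_lt_one hs).2 hrs)).mul_left C)
  calc ‖c n‖ * r ^ n = (‖c n‖ * s ^ n) * (r / s) ^ n := by rw [div_pow]; field_simp
    _ ≤ C * (r / s) ^ n := mul_le_mul_of_nonneg_right (hC n) (by positivity)

theorem GeomBounded.hasSum {R : ℝ} {c : ℕ → ℂ} (h : GeomBounded R c) {z : ℂ} (hz : ‖z‖ < R) :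
    HasSum (fun n => c n * z ^ n) (powerSum c z) := by
  refine Summable.hasSum (Summable.of_norm ?_)
  simpa only [norm_mul, norm_pow] using h.summable_norm (norm_nonneg z) hz

theorem powerSum_zero (c : ℕ → ℂ) : powerSum c 0 = c 0 := by
  rw [powerSum, tsum_eq_single 0]
  · simp
  · intro n hn; simp [hn]

theorem GeomBounded.hasDerivAt {R : ℝ} {c : ℕ → ℂ} (h : GeomBounded R c) {z : ℂ} (hz : ‖z‖ < R) :
    HasDerivAt (powerSum c) (powerSum (_root_.derivCoeff c) z) z := by
  obtain ⟨r, hzr, hrR⟩ := exists_between hz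
  have hr : 0 ≤ r := (norm_nonneg z).trans hzr.le
  have hu : Summable fun n : ℕ => ‖c n‖ * (n * r ^ (n - 1)) := by
    rw [← summable_nat_add_iff 1]
    refine (h.derivCoeff.summable_norm hr hrR).congr fun n => ?_
    rw [_root_.derivCoeff, norm_mul, ← Nat.cast_succ, Complex.norm_natCast, Nat.add_sub_cancel]
    push_cast; ring
  have key := hasDerivAt_tsum_of_isPreconnected (g := fun n w => c n * w ^ n)
    (g' := fun n w => c n * (n * w ^ (n - 1))) (t := Metric.ball 0 r) (y₀ := z) (y := z)
    hu Metric.isOpen_ball (convex_ball (0 : ℂ) r).isPreconnected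
    (fun n w _ => (hasDerivAt_pow n w).const_mul (c n))
    (fun n w hw => by
      rw [norm_mul, norm_mul, norm_pow, Complex.norm_natCast]
      have : ‖w‖ ≤ r := (mem_ball_zero_iff.1 hw).le
      gcongr)
    (mem_ball_zero_iff.2 hzr) (h.hasSum hz).summable (mem_ball_zero_iff.2 hzr)
  have hsum : Summable fun n : ℕ => c n * (n * z ^ (n - 1)) := by
    refine Summable.of_norm_bounded hu fun n => ?_
    rw [norm_mul, norm_mul, norm_pow, Complex.norm_natCast]
    gcongr
  refine key.congr_deriv ?_
  rw [hsum.tsum_eq_zero_add, Nat.cast_zero, zero_mul, mul_zero, zero_add]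
  refine tsum_congr fun n => ?_
  rw [_root_.derivCoeff, Nat.add_sub_cancel]
  push_cast
  ring

theorem hasSum_shiftCoeff {c : ℕ → ℂ} {z s : ℂ} (h : HasSum (fun n => c n * z ^ n) s) :
    HasSum (fun n => shiftCoeff c n * z ^ n) (z * s) := by
  rw [← hasSum_nat_add_iff' 1]
  simp only [Finset.sum_range_one, shiftCoeff, zero_mul, sub_zero]
  have e : (fun n => c n * z ^ (n + 1)) = fun n => z * (c n * z ^ n) :=
    funext fun n => by rw [pow_succ]; ring
  rw [e]
  exact h.mul_left z

theorem GeomBounded.hasDerivAt_mul {R : ℝ} {c : ℕ → ℂ} (h : GeomBounded R c) {z : ℂ}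
    (hz : ‖z‖ < R) :
    HasDerivAt (fun w => w * powerSum c w) (powerSum (fun n => ((n : ℂ) + 1) * c n) z) z := by
  have h1 := h.shiftCoeff.hasDerivAt hz
  refine h1.congr_of_eventuallyEq ?_
  have : Metric.ball (0 : ℂ) R ∈ 𝓝 z := Metric.isOpen_ball.mem_nhds (mem_ball_zero_iff.2 hz)
  filter_upwards [this] with w hw
  exact (hasSum_shiftCoeff (h.hasSum (mem_ball_zero_iff.1 hw))).tsum_eq.symm

theorem GeomBounded.powerSum_eq {R : ℝ} {c : ℕ → ℂ} (h : GeomBounded R c) {z : ℂ}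
    (hz : ‖z‖ < R) : powerSum c z = c 0 + z * powerSum (fun n => c (n + 1)) z := by
  rw [powerSum, (h.hasSum hz).summable.tsum_eq_zero_add, powerSum, ← tsum_mul_left]
  simp only [pow_zero, mul_one]
  congr 1
  exact tsum_congr fun n => by ring

/-! ### The confluent Heun function -/

/-- For r < 1 the limits give ‖P n‖ r + ‖Q n‖ r² < 1 from some N on, so a bound on two consecutive
values of ‖c n‖ rⁿ passes to the next. -/
theorem geomBounded_of_recurrence {c P Q : ℕ → ℂ}
    (hc : ∀ n, c (n + 2) = P n * c (n + 1) + Q n * c n)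
    (hP : Tendsto P atTop (𝓝 1)) (hQ : Tendsto Q atTop (𝓝 0)) : GeomBounded 1 c := by
  intro r hr hr1
  have hlim : Tendsto (fun n => ‖P n‖ * r + ‖Q n‖ * r ^ 2) atTop
      (𝓝 (‖(1 : ℂ)‖ * r + ‖(0 : ℂ)‖ * r ^ 2)) :=
    (hP.norm.mul_const r).add (hQ.norm.mul_const (r ^ 2))
  have hev : ∀ᶠ n in atTop, ‖P n‖ * r + ‖Q n‖ * r ^ 2 < 1 :=
    hlim.eventually_lt_const (by simpa using hr1)
  obtain ⟨N, hN⟩ := eventually_atTop.1 hev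
  set d : ℕ → ℝ := fun n => ‖c n‖ * r ^ n with hd
  have hd0 : ∀ n, 0 ≤ d n := fun n => by positivity
  -- The sum dominates each of the first N + 2 terms; beyond them the recurrence takes over.
  set M : ℝ := ∑ n ∈ Finset.range (N + 2), d n with hM
  have hM0 : 0 ≤ M := Finset.sum_nonneg fun n _ => hd0 n
  refine ⟨M, fun n => ?_⟩
  change d n ≤ M
  induction n using Nat.strong_induction_on with
  | _ n ih =>
    by_cases hn : n < N + 2
    · exact Finset.single_le_sum (f := d) (fun i _ => hd0 i) (Finset.mem_range.2 hn)
    · obtain ⟨m, rfl⟩ : ∃ m, n = m + 2 := ⟨n - 2, by omega⟩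
      have h1 := ih (m + 1) (by omega)
      have h2 := ih m (by omega)
      calc d (m + 2) ≤ (‖P m‖ * ‖c (m + 1)‖ + ‖Q m‖ * ‖c m‖) * r ^ (m + 2) := by
            simp only [hd, hc]
            gcongr
            exact (norm_add_le _ _).trans (by simp)
        _ = ‖P m‖ * r * d (m + 1) + ‖Q m‖ * r ^ 2 * d m := by simp only [hd]; ring
        _ ≤ ‖P m‖ * r * M + ‖Q m‖ * r ^ 2 * M := by gcongr
        _ = (‖P m‖ * r + ‖Q m‖ * r ^ 2) * M := by ring
        _ ≤ 1 * M := mul_le_mul_of_nonneg_right (hN m (by omega)).le hM0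
        _ = M := one_mul M

theorem tendsto_const_div_natCast_add_atTop (a b : ℂ) :
    Tendsto (fun n : ℕ => a / ((n : ℂ) + b)) atTop (𝓝 0) := by
  have h : Tendsto (fun n : ℕ => (n : ℂ) + b) atTop (Bornology.cobounded ℂ) :=
    (tendsto_add_const_cobounded b).comp tendsto_natCast_atTop_cobounded
  simpa [div_eq_mul_inv] using (tendsto_inv₀_cobounded.comp h).const_mul a

theorem geomBounded_heunCoeff (α β γ δ η : ℂ) (hβ : ∀ n : ℕ, β ≠ -((n : ℂ) + 1)) :
    GeomBounded 1 (heunCoeff α β γ δ η) := by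
  have h2 : ∀ n : ℕ, (n : ℂ) + 2 ≠ 0 := fun n => by exact_mod_cast (Nat.succ_ne_zero (n + 1))
  have h2β : ∀ n : ℕ, (n : ℂ) + (2 + β) ≠ 0 := fun n h => hβ (n + 1) (by
    push_cast; linear_combination h)
  have hβ' : ∀ n : ℕ, (n : ℂ) + 2 + β ≠ 0 := fun n => by rw [add_assoc]; exact h2β n
  have t := tendsto_const_div_natCast_add_atTop
  refine geomBounded_of_recurrence
    -- The recurrence coefficients are split into terms a / (n + b), whose limits are immediate.
    (P := fun n => (1 - 1 / ((n : ℂ) + 2)) * (1 + (γ - α) / ((n : ℂ) + (2 + β)))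
      + ((1 + γ - α) * β + γ - α + 2 * η) / 2 / ((n : ℂ) + 2) * (1 / ((n : ℂ) + (2 + β))))
    (Q := fun n => α * (1 - 2 / ((n : ℂ) + 2)) * (1 / ((n : ℂ) + (2 + β)))
      + ((β + γ + 2) * α + 2 * δ) / 2 / ((n : ℂ) + 2) * (1 / ((n : ℂ) + (2 + β)))) ?_ ?_ ?_
  · intro n
    have a := h2 n
    have b := h2β n
    have b' := hβ' n
    rw [heunCoeff]
    field_simp
    ring
  · have := (((tendsto_const_nhds (x := (1 : ℂ))).sub (t 1 2)).mul
      ((tendsto_const_nhds (x := (1 : ℂ))).add (t (γ - α) (2 + β)))).add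
      ((t (((1 + γ - α) * β + γ - α + 2 * η) / 2) 2).mul (t 1 (2 + β)))
    simpa using this
  · have := (((tendsto_const_nhds (x := (1 : ℂ))).sub (t 2 2)).const_mul α |>.mul
      (t 1 (2 + β))).add ((t (((β + γ + 2) * α + 2 * δ) / 2) 2).mul (t 1 (2 + β)))
    simpa using this

theorem deriv_heunC {α β γ δ η : ℂ} (hβ : ∀ n : ℕ, β ≠ -((n : ℂ) + 1)) {x : ℂ} (hx : ‖x‖ < 1) :
    deriv (heunC α β γ δ η) x = powerSum (derivCoeff (heunCoeff α β γ δ η)) x :=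
  ((geomBounded_heunCoeff α β γ δ η hβ).hasDerivAt hx).deriv

theorem deriv_deriv_heunC {α β γ δ η : ℂ} (hβ : ∀ n : ℕ, β ≠ -((n : ℂ) + 1)) {x : ℂ}
    (hx : ‖x‖ < 1) :
    deriv (deriv (heunC α β γ δ η)) x =
      powerSum (derivCoeff (derivCoeff (heunCoeff α β γ δ η))) x := by
  have hev : deriv (heunC α β γ δ η) =ᶠ[𝓝 x] powerSum (derivCoeff (heunCoeff α β γ δ η)) := by
    have : Metric.ball (0 : ℂ) 1 ∈ 𝓝 x := Metric.isOpen_ball.mem_nhds (mem_ball_zero_iff.2 hx)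
    filter_upwards [this] with w hw
    exact deriv_heunC hβ (mem_ball_zero_iff.1 hw)
  rw [hev.deriv_eq]
  exact ((geomBounded_heunCoeff α β γ δ η hβ).derivCoeff.hasDerivAt hx).deriv

/-- The left-hand side of the confluent Heun equation multiplied by `x (x - 1)`. -/
noncomputable def heunOperator (α β γ δ η : ℂ) (y : ℂ → ℂ) (x : ℂ) : ℂ :=
  x * (x - 1) * deriv (deriv y) x + heunK α β γ x * deriv y x
    + (((β + γ + 2) * α + 2 * δ) * x - (β + 1) * α + (γ + 1) * β + 2 * η + γ) / 2 * y x

theorem heunOperator_heunC {α β γ δ η : ℂ} (hβ : ∀ n : ℕ, β ≠ -((n : ℂ) + 1)) {x : ℂ}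
    (hx : ‖x‖ < 1) : heunOperator α β γ δ η (heunC α β γ δ η) x = 0 := by
  set c := heunCoeff α β γ δ η with hc
  have hb : GeomBounded 1 c := geomBounded_heunCoeff α β γ δ η hβ
  have e0 : heunC α β γ δ η x = powerSum c x := rfl
  rw [heunOperator, deriv_heunC hβ hx, deriv_deriv_heunC hβ hx, e0]
  have s0 := hb.hasSum hx
  have s1 := hb.derivCoeff.hasSum hx
  have s2 := hb.derivCoeff.derivCoeff.hasSum hx
  have x0 := hasSum_shiftCoeff s0
  have x1 := hasSum_shiftCoeff s1
  have x2 := hasSum_shiftCoeff s2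
  have xx1 := hasSum_shiftCoeff x1
  have xx2 := hasSum_shiftCoeff x2
  have total := ((((((xx2.sub x2).add (xx1.mul_left α)).add
    (x1.mul_left (2 + β + γ - α))).add (s1.mul_left (-(β + 1)))).add
    (x0.mul_left (((β + γ + 2) * α + 2 * δ) / 2))).add
    (s0.mul_left ((-(β + 1) * α + (γ + 1) * β + 2 * η + γ) / 2)))
  have hzero : ∀ n : ℕ,
      shiftCoeff (shiftCoeff (derivCoeff (derivCoeff c))) n
        - shiftCoeff (derivCoeff (derivCoeff c)) n
        + α * shiftCoeff (shiftCoeff (derivCoeff c)) n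
        + (2 + β + γ - α) * shiftCoeff (derivCoeff c) n
        + -(β + 1) * derivCoeff c n
        + ((β + γ + 2) * α + 2 * δ) / 2 * shiftCoeff c n
        + (-(β + 1) * α + (γ + 1) * β + 2 * η + γ) / 2 * c n = 0 := by
    have rec2 : ∀ n : ℕ, ((n : ℂ) + 2) * ((n : ℂ) + 2 + β) * c (n + 2) =
        (((n : ℂ) + 1) * ((n : ℂ) + 2 + β + γ - α)
          + ((1 + γ - α) * β + γ - α + 2 * η) / 2) * c (n + 1)
        + (α * (n : ℂ) + ((β + γ + 2) * α + 2 * δ) / 2) * c n := by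
      intro n
      have a : (n : ℂ) + 2 ≠ 0 := by exact_mod_cast (Nat.succ_ne_zero (n + 1))
      have b : (n : ℂ) + 2 + β ≠ 0 := fun h => hβ (n + 1) (by push_cast; linear_combination h)
      rw [hc, heunCoeff]
      field_simp
    have rec1 : (1 + β) * c 1 = ((1 + γ - α) * β + γ - α + 2 * η) / 2 * c 0 := by
      have b : 1 + β ≠ 0 := fun h => hβ 0 (by push_cast; linear_combination h)
      simp only [hc, heunCoeff]
      field_simp
    intro n
    -- The terms carrying x² are shifted twice, so n = 0 and n = 1 are boundary cases.
    match n with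
    | 0 =>
      simp only [shiftCoeff, derivCoeff, Nat.cast_zero]
      linear_combination -rec1
    | 1 =>
      have := rec2 0
      simp only [shiftCoeff, derivCoeff, Nat.cast_zero, Nat.cast_one, zero_add] at this ⊢
      linear_combination -this
    | n + 2 =>
      have := rec2 (n + 1)
      simp only [shiftCoeff, derivCoeff]
      push_cast at this ⊢
      linear_combination -this
  have hz : HasSum (fun _ : ℕ => (0 : ℂ)) _ := total.congr_fun fun n => by
    linear_combination -(x ^ n) * hzero n
  have := hz.unique hasSum_zero
  rw [heunK]
  linear_combination this

theorem heun_equation_of_heunOperator {α β γ δ η : ℂ} {y : ℂ → ℂ} {x : ℂ} (hx0 : x ≠ 0)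
    (hx1 : x ≠ 1) (h : heunOperator α β γ δ η y x = 0) :
    deriv (deriv y) x + heunP α β γ x * deriv y x + heunQ α β γ δ η x * y x = 0 := by
  have h1 : x - 1 ≠ 0 := sub_ne_zero.2 hx1
  have : deriv (deriv y) x + heunP α β γ x * deriv y x + heunQ α β γ δ η x * y x
      = heunOperator α β γ δ η y x / (x * (x - 1)) := by
    rw [heunOperator, heunP, heunQ, heunK]
    field_simp
    ring
  rw [this, h, zero_div]

theorem isHeunCContinuation_ball {α β γ δ η : ℂ} (hβ : ∀ n : ℕ, β ≠ -((n : ℂ) + 1)) :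
    IsHeunCContinuation α β γ δ η (Metric.ball 0 1) (heunC α β γ δ η) where
  isOpen := Metric.isOpen_ball
  isPreconnected := (convex_ball 0 1).isPreconnected
  zero_mem := Metric.mem_ball_self one_pos
  analytic := fun _ hx => ((geomBounded_heunCoeff α β γ δ η hβ).hasDerivAt
    (mem_ball_zero_iff.1 hx)).differentiableAt.differentiableWithinAt
  germ := EventuallyEq.rfl

theorem IsHeunCContinuation.analyticOnNhd {α β γ δ η : ℂ} {U : Set ℂ} {H : ℂ → ℂ}
    (h : IsHeunCContinuation α β γ δ η U H) : AnalyticOnNhd ℂ H U :=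
  h.analytic.analyticOnNhd h.isOpen

/-- Every analytic continuation of the confluent Heun function solves the equation. -/
theorem IsHeunCContinuation.heunOperator_eq_zero {α β γ δ η : ℂ} {U : Set ℂ} {H : ℂ → ℂ}
    (h : IsHeunCContinuation α β γ δ η U H) (hβ : ∀ n : ℕ, β ≠ -((n : ℂ) + 1)) {x : ℂ}
    (hx : x ∈ U) : heunOperator α β γ δ η H x = 0 := by
  have hH := h.analyticOnNhd
  -- Clearing the denominator x(x-1) makes this analytic on all of U, even at 0 and 1, so the
  -- identity theorem can start from the germ at 0.
  have hE : AnalyticOnNhd ℂ (heunOperator α β γ δ η H) U := by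
    intro w hw
    have a0 := hH w hw
    have a1 := hH.deriv w hw
    have a2 := hH.deriv.deriv w hw
    unfold heunOperator heunK
    fun_prop
  refine hE.eqOn_zero_of_preconnected_of_eventuallyEq_zero h.isPreconnected h.zero_mem ?_ hx
  have hball : Metric.ball (0 : ℂ) 1 ∈ 𝓝 (0 : ℂ) := Metric.ball_mem_nhds 0 one_pos
  filter_upwards [h.germ, h.germ.deriv, h.germ.deriv.deriv, hball] with w e0 e1 e2 hw
  have := heunOperator_heunC (α := α) (γ := γ) (δ := δ) (η := η) hβ (mem_ball_zero_iff.1 hw)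
  rw [heunOperator] at this ⊢
  rw [e0, e1, e2]
  exact this

/-! ### Bessel functions along a ray -/

theorem geomBounded_of_norm_le_factorial {c : ℕ → ℂ} {M : ℝ}
    (h : ∀ n, ‖c n‖ ≤ M / (n.factorial : ℝ)) (R : ℝ) : GeomBounded R c := by
  intro r hr _
  have hM : 0 ≤ M := by simpa using (norm_nonneg _).trans (h 0)
  refine ⟨M * Real.exp r, fun n => ?_⟩
  calc ‖c n‖ * r ^ n ≤ M / (n.factorial : ℝ) * r ^ n := by gcongr; exact h n
    _ = M * (r ^ n / (n.factorial : ℝ)) := by ring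
    _ ≤ M * Real.exp r := by gcongr; exact Real.pow_div_factorial_le_exp r hr.le n

/-- Coefficients of `J_n(z) (z / 2) ^ (-n)` as a power series in `(z / 2) ^ 2`. -/
noncomputable def besselJCoeff (n k : ℕ) : ℂ :=
  (-1) ^ k / ((k.factorial : ℂ) * ((n + k).factorial : ℂ))

/-- Coefficients of the digamma part of `Y_n(z) (z / 2) ^ (-n)` as a power series in
`(z / 2) ^ 2`. -/
noncomputable def besselYCoeff (n k : ℕ) : ℂ :=
  (-1) ^ k * (psiSucc k + psiSucc (n + k)) / ((k.factorial : ℂ) * ((n + k).factorial : ℂ))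

theorem geomBounded_besselJCoeff (n : ℕ) (R : ℝ) : GeomBounded R (besselJCoeff n) := by
  refine geomBounded_of_norm_le_factorial (M := 1) (fun k => ?_) R
  have h1 : (1 : ℝ) ≤ ((n + k).factorial : ℝ) := by exact_mod_cast (n + k).factorial_pos
  have h2 : (0 : ℝ) < (k.factorial : ℝ) := by exact_mod_cast k.factorial_pos
  simp only [besselJCoeff, norm_div, norm_mul, norm_pow, norm_neg, norm_one, one_pow,
    Complex.norm_natCast]
  gcongr
  exact le_mul_of_one_le_right h2.le h1

theorem psiSucc_succ (m : ℕ) : psiSucc (m + 1) = psiSucc m + 1 / ((m : ℂ) + 1) := by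
  rw [psiSucc, psiSucc, harmonic_succ]
  push_cast
  ring

/-- The growth is really logarithmic. The factorial form lets this bound cancel (n+k)! in
`besselYCoeff`, leaving 4/k!. -/
theorem norm_psiSucc_le (m : ℕ) : ‖psiSucc m‖ ≤ 2 * (m.factorial : ℝ) := by
  have key : ‖psiSucc m‖ ≤ (m : ℝ) + 1 := by
    induction m with
    | zero =>
      have h0 : 0 < Real.eulerMascheroniConstant :=
        (by norm_num : (0 : ℝ) < 1 / 2).trans Real.one_half_lt_eulerMascheroniConstant
      have h1 := Real.eulerMascheroniConstant_lt_two_thirds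
      simp only [psiSucc, harmonic_zero, Rat.cast_zero, zero_sub, norm_neg, Complex.norm_real,
        Real.norm_eq_abs, abs_of_pos h0, Nat.cast_zero, zero_add]
      linarith
    | succ m ih =>
      rw [psiSucc_succ]
      refine (norm_add_le _ _).trans ?_
      have : ‖1 / ((m : ℂ) + 1)‖ ≤ 1 := by
        rw [← Nat.cast_succ, norm_div, Complex.norm_natCast, norm_one]
        refine (div_le_one (by positivity)).2 ?_
        exact_mod_cast Nat.succ_pos m
      push_cast
      linarith
  refine key.trans ?_
  have : m ≤ m.factorial := Nat.self_le_factorial m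
  have h' : 1 ≤ m.factorial := m.factorial_pos
  exact_mod_cast (by omega : m + 1 ≤ 2 * m.factorial)

theorem geomBounded_besselYCoeff (n : ℕ) (R : ℝ) : GeomBounded R (besselYCoeff n) := by
  refine geomBounded_of_norm_le_factorial (M := 4) (fun k => ?_) R
  have h0 : (k.factorial : ℝ) ≤ ((n + k).factorial : ℝ) := by
    exact_mod_cast Nat.factorial_le (Nat.le_add_left k n)
  have h1 : (0 : ℝ) < ((n + k).factorial : ℝ) := by exact_mod_cast (n + k).factorial_pos
  have h2 : (0 : ℝ) < (k.factorial : ℝ) := by exact_mod_cast k.factorial_pos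
  have h3 : ‖psiSucc k + psiSucc (n + k)‖ ≤ 4 * ((n + k).factorial : ℝ) := by
    refine (norm_add_le _ _).trans ?_
    linarith [norm_psiSucc_le k, norm_psiSucc_le (n + k)]
  simp only [besselYCoeff, norm_div, norm_mul, norm_pow, norm_neg, norm_one, one_pow,
    Complex.norm_natCast, one_mul]
  rw [div_le_div_iff₀ (by positivity) h2]
  nlinarith

theorem besselJ_eq (n : ℕ) (z : ℂ) :
    besselJ n z = (z / 2) ^ n * powerSum (besselJCoeff n) ((z / 2) ^ 2) := by
  rw [besselJ, powerSum, ← tsum_mul_left]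
  refine tsum_congr fun k => ?_
  rw [besselJCoeff, pow_add, pow_mul]
  ring

theorem besselY_tsum_eq (n : ℕ) (z : ℂ) :
    ∑' k : ℕ, (-1) ^ k * (psiSucc k + psiSucc (n + k))
        / ((k.factorial : ℂ) * ((n + k).factorial : ℂ)) * (z / 2) ^ (2 * k + n)
      = (z / 2) ^ n * powerSum (besselYCoeff n) ((z / 2) ^ 2) := by
  rw [powerSum, ← tsum_mul_left]
  refine tsum_congr fun k => ?_
  rw [besselYCoeff, pow_add, pow_mul]
  ring

theorem besselY_zero_eq (z : ℂ) :
    besselY 0 z = 2 / (Real.pi : ℂ) * Complex.log (z / 2) * powerSum (besselJCoeff 0) ((z / 2) ^ 2)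
      - 1 / (Real.pi : ℂ) * powerSum (besselYCoeff 0) ((z / 2) ^ 2) := by
  rw [besselY, besselY_tsum_eq, besselJ_eq]
  simp

theorem besselY_one_eq (z : ℂ) :
    besselY 1 z =
      2 / (Real.pi : ℂ) * Complex.log (z / 2) * (z / 2 * powerSum (besselJCoeff 1) ((z / 2) ^ 2))
      - 1 / (Real.pi : ℂ) * (z / 2)⁻¹
      - 1 / (Real.pi : ℂ) * (z / 2 * powerSum (besselYCoeff 1) ((z / 2) ^ 2)) := by
  rw [besselY, besselY_tsum_eq, besselJ_eq]
  simp

/-- With J₀ = A₀(w) and J₁ = (z/2) A₁(w), where w = (z/2)², the relation J₀' = -J₁ reads A₀' = -A₁;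
the next lemma gives (wA₁)' = A₀. -/
theorem derivCoeff_besselJCoeff_zero :
    derivCoeff (besselJCoeff 0) = fun k => -besselJCoeff 1 k := by
  funext k
  have h : (k.factorial : ℂ) ≠ 0 := by exact_mod_cast k.factorial_ne_zero
  have h' : (k : ℂ) + 1 ≠ 0 := by exact_mod_cast k.succ_ne_zero
  simp only [derivCoeff, besselJCoeff, zero_add, Nat.add_comm 1 k, Nat.factorial_succ, pow_succ]
  push_cast
  field_simp

theorem succ_mul_besselJCoeff_one (k : ℕ) :
    ((k : ℂ) + 1) * besselJCoeff 1 k = besselJCoeff 0 k := by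
  have h : (k.factorial : ℂ) ≠ 0 := by exact_mod_cast k.factorial_ne_zero
  have h' : (k : ℂ) + 1 ≠ 0 := by exact_mod_cast k.succ_ne_zero
  simp only [besselJCoeff, zero_add, Nat.add_comm 1 k, Nat.factorial_succ]
  push_cast
  field_simp

theorem besselJCoeff_zero_succ (k : ℕ) :
    besselJCoeff 0 (k + 1) = derivCoeff (besselYCoeff 0) k + besselYCoeff 1 k := by
  have h : (k.factorial : ℂ) ≠ 0 := by exact_mod_cast k.factorial_ne_zero
  have h' : (k : ℂ) + 1 ≠ 0 := by exact_mod_cast k.succ_ne_zero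
  simp only [derivCoeff, besselJCoeff, besselYCoeff, zero_add, Nat.add_comm 1 k,
    Nat.factorial_succ, pow_succ, psiSucc_succ]
  push_cast
  field_simp
  ring

theorem succ_mul_besselYCoeff_one (k : ℕ) :
    ((k : ℂ) + 1) * besselYCoeff 1 k = besselYCoeff 0 k + besselJCoeff 1 k := by
  have h : (k.factorial : ℂ) ≠ 0 := by exact_mod_cast k.factorial_ne_zero
  have h' : (k : ℂ) + 1 ≠ 0 := by exact_mod_cast k.succ_ne_zero
  simp only [besselJCoeff, besselYCoeff, zero_add, Nat.add_comm 1 k,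
    Nat.factorial_succ, psiSucc_succ]
  push_cast
  field_simp
  ring

theorem hasDerivAt_powerSum_besselJCoeff_zero (w : ℂ) :
    HasDerivAt (powerSum (besselJCoeff 0)) (-powerSum (besselJCoeff 1) w) w := by
  have h := (geomBounded_besselJCoeff 0 (‖w‖ + 1)).hasDerivAt (lt_add_one ‖w‖)
  rw [derivCoeff_besselJCoeff_zero] at h
  convert h using 1
  simp only [powerSum, neg_mul, tsum_neg]

theorem hasDerivAt_mul_powerSum_besselJCoeff_one (w : ℂ) :
    HasDerivAt (fun w => w * powerSum (besselJCoeff 1) w) (powerSum (besselJCoeff 0) w) w := by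
  have h := (geomBounded_besselJCoeff 1 (‖w‖ + 1)).hasDerivAt_mul (lt_add_one ‖w‖)
  simpa only [succ_mul_besselJCoeff_one] using h

/-- This is the part of Y₀' = -Y₁ free of logarithms: A₀ arises from differentiating log(z/2), and
the -1 is the polar term of Y₁. Multiplying by w keeps the relation valid at w = 0. -/
theorem hasDerivAt_powerSum_besselYCoeff_zero (w : ℂ) :
    ∃ d, HasDerivAt (powerSum (besselYCoeff 0)) d w ∧
      w * d = powerSum (besselJCoeff 0) w - 1 - w * powerSum (besselYCoeff 1) w := by
  have hw := lt_add_one ‖w‖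
  have hb := geomBounded_besselYCoeff 0 (‖w‖ + 1)
  refine ⟨_, hb.hasDerivAt hw, ?_⟩
  have hsum := ((hb.derivCoeff.hasSum hw).add ((geomBounded_besselYCoeff 1 _).hasSum hw)).tsum_eq
  rw [(geomBounded_besselJCoeff 0 (‖w‖ + 1)).powerSum_eq hw]
  have : powerSum (fun n => besselJCoeff 0 (n + 1)) w
      = powerSum (derivCoeff (besselYCoeff 0)) w + powerSum (besselYCoeff 1) w := by
    rw [← hsum, powerSum]
    exact tsum_congr fun k => by rw [besselJCoeff_zero_succ, add_mul]
  rw [this]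
  simp only [besselJCoeff, pow_zero, Nat.factorial_zero, Nat.cast_one, mul_one, div_one, add_zero]
  ring

/-- The extra J₁ series cancels the one produced by the derivative of the logarithm in (zY₁)'. -/
theorem hasDerivAt_mul_powerSum_besselYCoeff_one (w : ℂ) :
    HasDerivAt (fun w => w * powerSum (besselYCoeff 1) w)
      (powerSum (besselYCoeff 0) w + powerSum (besselJCoeff 1) w) w := by
  have hw := lt_add_one ‖w‖
  have h := (geomBounded_besselYCoeff 1 (‖w‖ + 1)).hasDerivAt_mul hw
  convert h using 1
  have hsum := (((geomBounded_besselYCoeff 0 _).hasSum hw).add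
    ((geomBounded_besselJCoeff 1 _).hasSum hw)).tsum_eq
  rw [← hsum, powerSum]
  exact tsum_congr fun k => by rw [succ_mul_besselYCoeff_one, add_mul]

/-! ### Derivatives of principal powers and logarithms along the real line -/

theorem hasDerivAt_ofReal_sub_cpow {x a : ℝ} (hx : x ≠ a) (r : ℂ) :
    HasDerivAt (fun y : ℝ => ((y : ℂ) - a) ^ (1 + r)) ((1 + r) * ((x : ℂ) - a) ^ r) x := by
  rcases eq_or_ne (1 + r) 0 with h | h
  · simpa [h] using hasDerivAt_const x (1 : ℂ)
  · have h1 := (hasDerivAt_ofReal_cpow_const (sub_ne_zero.2 hx) h).comp_sub_const x a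
    simpa using h1

theorem ofReal_cpow_add_one {x : ℝ} (hx : x ≠ 0) (r : ℂ) :
    (x : ℂ) ^ (1 + r) = x * (x : ℂ) ^ r := by
  rw [Complex.cpow_add _ _ (Complex.ofReal_ne_zero.2 hx), Complex.cpow_one]

/-- On each side of 0 the point a√y stays on a fixed ray, so its principal logarithm is (1/2) log|y|
plus a constant and the branch cut is never crossed. -/
theorem hasDerivAt_log_mul_ofReal_sqrt {a : ℂ} (ha : a ≠ 0) {x : ℝ} (hx : x ≠ 0) :
    HasDerivAt (fun y : ℝ => Complex.log (a * (y : ℂ) ^ (1 / 2 : ℂ))) (1 / (2 * x)) x := by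
  have hlog : ∀ b : ℂ, HasDerivAt (fun y : ℝ => ((1 / 2 * Real.log y : ℝ) : ℂ) + b)
      (1 / (2 * x)) x := by
    intro b
    have := (((Real.hasDerivAt_log hx).const_mul (1 / 2)).ofReal_comp).add_const b
    refine this.congr_deriv ?_
    push_cast
    field_simp
  have hpos : ∀ (b : ℂ) (y : ℝ), b ≠ 0 → 0 < y →
      Complex.log (b * (y : ℂ) ^ (1 / 2 : ℂ)) = ((1 / 2 * Real.log y : ℝ) : ℂ) + Complex.log b := by
    intro b y hb hy
    have : (y : ℂ) ^ (1 / 2 : ℂ) = ((y ^ (1 / 2 : ℝ) : ℝ) : ℂ) := by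
      rw [Complex.ofReal_cpow hy.le]
      norm_num
    rw [this, mul_comm, Complex.log_ofReal_mul (Real.rpow_pos_of_pos hy _) hb, Real.log_rpow hy]
  rcases hx.lt_or_gt with h | h
  -- For y < 0 the principal root is i√(-y); the constant i = exp(πi/2) joins a.
  · have hb : a * Complex.exp (Real.pi * Complex.I * (1 / 2)) ≠ 0 :=
      mul_ne_zero ha (Complex.exp_ne_zero _)
    refine (hlog (Complex.log
      (a * Complex.exp (Real.pi * Complex.I * (1 / 2))))).congr_of_eventuallyEq ?_
    filter_upwards [Iio_mem_nhds h] with y hy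
    have hy' : 0 < -y := neg_pos.2 hy
    rw [Complex.ofReal_cpow_of_nonpos (le_of_lt hy), ← Real.log_neg_eq_log y, ← hpos _ _ hb hy']
    push_cast
    ring_nf
  · refine (hlog (Complex.log a)).congr_of_eventuallyEq ?_
    filter_upwards [Ioi_mem_nhds h] with y hy
    exact hpos a y ha hy

theorem sqrtSubOne_sq (x : ℝ) : sqrtSubOne x ^ 2 = (x : ℂ) - 1 := by
  rw [sqrtSubOne, ← Complex.cpow_nat_mul]
  norm_num

theorem sqrtSubOne_ne_zero {x : ℝ} (hx : x ≠ 1) : sqrtSubOne x ≠ 0 := by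
  have h : (x : ℂ) - 1 ≠ 0 := by
    rw [sub_ne_zero]
    exact_mod_cast hx
  intro h0
  apply h
  rw [← sqrtSubOne_sq, h0]
  norm_num

theorem half_mul_sqrtSubOne_sq (Ω : ℂ) (x : ℝ) :
    (Ω * sqrtSubOne x / 2) ^ 2 = Ω ^ 2 / 4 * ((x : ℂ) - 1) := by
  rw [← sqrtSubOne_sq]
  ring

theorem hasDerivAt_log_half_mul_sqrtSubOne {Ω : ℂ} (hΩ : Ω ≠ 0) {x : ℝ} (hx : x ≠ 1) :
    HasDerivAt (fun y : ℝ => Complex.log (Ω * sqrtSubOne y / 2)) (1 / (2 * ((x : ℂ) - 1))) x := by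
  have h := (hasDerivAt_log_mul_ofReal_sqrt (a := Ω / 2) (div_ne_zero hΩ two_ne_zero)
    (sub_ne_zero.2 hx)).comp_sub_const x 1
  have e : (fun y : ℝ => Complex.log (Ω * sqrtSubOne y / 2)) =
      fun y : ℝ => Complex.log (Ω / 2 * ((y - 1 : ℝ) : ℂ) ^ (1 / 2 : ℂ)) := by
    funext y
    rw [sqrtSubOne, Complex.ofReal_sub, Complex.ofReal_one]
    ring_nf
  rw [e]
  simpa using h

/-! ### The Bessel system satisfied by `B₀(Ω √(x - 1))` and `(2 / Ω) √(x - 1) B₁(Ω √(x - 1))` -/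

/-- At every real `x ≠ 1` the functions `B₀, B₁` satisfy `B₀' = -B₁` and `(z B₁)' = z B₀`
along `z = Ω √(x - 1)`, written in terms of `x`. -/
def IsBesselPairAlong (Ω : ℂ) (B₀ B₁ : ℂ → ℂ) : Prop :=
  ∀ x : ℝ, x ≠ 1 →
    HasDerivAt (fun y : ℝ => B₀ (Ω * sqrtSubOne y))
      (-(Ω ^ 2 / 4 / ((x : ℂ) - 1)) * (2 / Ω * sqrtSubOne x * B₁ (Ω * sqrtSubOne x))) x ∧
    HasDerivAt (fun y : ℝ => 2 / Ω * sqrtSubOne y * B₁ (Ω * sqrtSubOne y))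
      (B₀ (Ω * sqrtSubOne x)) x

theorem hasDerivAt_mul_ofReal_sub_one (a : ℂ) (x : ℝ) :
    HasDerivAt (fun y : ℝ => a * ((y : ℂ) - 1)) a x := by
  simpa using (((hasDerivAt_id x).ofReal_comp).sub_const (1 : ℂ)).const_mul a

theorem isBesselPairAlong_besselJ {Ω : ℂ} (hΩ : Ω ≠ 0) :
    IsBesselPairAlong Ω (besselJ 0) (besselJ 1) := by
  intro x hx
  have hx1 : (x : ℂ) - 1 ≠ 0 := by
    rw [sub_ne_zero]
    exact_mod_cast hx
  have e0 : ∀ y : ℝ, besselJ 0 (Ω * sqrtSubOne y) =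
      powerSum (besselJCoeff 0) (Ω ^ 2 / 4 * ((y : ℂ) - 1)) := fun y => by
    rw [besselJ_eq, half_mul_sqrtSubOne_sq, pow_zero, one_mul]
  have e1 : ∀ y : ℝ, 2 / Ω * sqrtSubOne y * besselJ 1 (Ω * sqrtSubOne y) =
      4 / Ω ^ 2 * (Ω ^ 2 / 4 * ((y : ℂ) - 1) *
        powerSum (besselJCoeff 1) (Ω ^ 2 / 4 * ((y : ℂ) - 1))) := fun y => by
    rw [besselJ_eq, half_mul_sqrtSubOne_sq, ← sqrtSubOne_sq]
    field_simp
  simp only [e0, e1]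
  have hw := hasDerivAt_mul_ofReal_sub_one (Ω ^ 2 / 4) x
  constructor
  · refine ((hasDerivAt_powerSum_besselJCoeff_zero
      (Ω ^ 2 / 4 * ((x : ℂ) - 1))).comp x hw).congr_deriv ?_
    field_simp
  · refine (((hasDerivAt_mul_powerSum_besselJCoeff_one
      (Ω ^ 2 / 4 * ((x : ℂ) - 1))).comp x hw).const_mul (4 / Ω ^ 2)).congr_deriv ?_
    field_simp

theorem isBesselPairAlong_besselY {Ω : ℂ} (hΩ : Ω ≠ 0) :
    IsBesselPairAlong Ω (besselY 0) (besselY 1) := by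
  intro x hx
  have hx1 : (x : ℂ) - 1 ≠ 0 := by
    rw [sub_ne_zero]
    exact_mod_cast hx
  have hπ : (Real.pi : ℂ) ≠ 0 := Complex.ofReal_ne_zero.2 Real.pi_ne_zero
  have e0 : ∀ y : ℝ, besselY 0 (Ω * sqrtSubOne y) =
      2 / (Real.pi : ℂ) * (Complex.log (Ω * sqrtSubOne y / 2) *
        powerSum (besselJCoeff 0) (Ω ^ 2 / 4 * ((y : ℂ) - 1)))
      - 1 / (Real.pi : ℂ) * powerSum (besselYCoeff 0) (Ω ^ 2 / 4 * ((y : ℂ) - 1)) := fun y => by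
    rw [besselY_zero_eq, half_mul_sqrtSubOne_sq, mul_assoc]
  have e1 : ∀ y : ℝ, y ≠ 1 → 2 / Ω * sqrtSubOne y * besselY 1 (Ω * sqrtSubOne y) =
      4 / Ω ^ 2 * (2 / (Real.pi : ℂ) * (Complex.log (Ω * sqrtSubOne y / 2) *
          (Ω ^ 2 / 4 * ((y : ℂ) - 1) * powerSum (besselJCoeff 1) (Ω ^ 2 / 4 * ((y : ℂ) - 1))))
        - 1 / (Real.pi : ℂ) * (Ω ^ 2 / 4 * ((y : ℂ) - 1) *
          powerSum (besselYCoeff 1) (Ω ^ 2 / 4 * ((y : ℂ) - 1)))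
        - 1 / (Real.pi : ℂ)) := fun y hy => by
    have hs := sqrtSubOne_ne_zero hy
    rw [besselY_one_eq, half_mul_sqrtSubOne_sq, ← sqrtSubOne_sq]
    field_simp
    ring
  have hw := hasDerivAt_mul_ofReal_sub_one (Ω ^ 2 / 4) x
  have hL := hasDerivAt_log_half_mul_sqrtSubOne hΩ hx
  obtain ⟨d, hd, hdeq⟩ := hasDerivAt_powerSum_besselYCoeff_zero (Ω ^ 2 / 4 * ((x : ℂ) - 1))
  have hJ0 := (hasDerivAt_powerSum_besselJCoeff_zero (Ω ^ 2 / 4 * ((x : ℂ) - 1))).comp x hw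
  have hJ1 := (hasDerivAt_mul_powerSum_besselJCoeff_one (Ω ^ 2 / 4 * ((x : ℂ) - 1))).comp x hw
  have hY0 := hd.comp x hw
  have hY1 := (hasDerivAt_mul_powerSum_besselYCoeff_one (Ω ^ 2 / 4 * ((x : ℂ) - 1))).comp x hw
  rw [e1 x hx, e0 x]
  constructor
  · simp only [e0]
    refine (((hL.mul hJ0).const_mul (2 / (Real.pi : ℂ))).sub
      (hY0.const_mul (1 / (Real.pi : ℂ)))).congr_deriv ?_
    -- Division by w is allowed because x ≠ 1.
    have hd' : d = (powerSum (besselJCoeff 0) (Ω ^ 2 / 4 * ((x : ℂ) - 1)) - 1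
        - Ω ^ 2 / 4 * ((x : ℂ) - 1) * powerSum (besselYCoeff 1) (Ω ^ 2 / 4 * ((x : ℂ) - 1)))
          / (Ω ^ 2 / 4 * ((x : ℂ) - 1)) := by
      rw [← hdeq]
      field_simp
    rw [hd']
    simp only [Function.comp_apply]
    generalize powerSum _ _ = a
    generalize powerSum _ _ = a
    generalize powerSum _ _ = a
    field_simp
    ring
  · have h := ((((hL.mul hJ1).const_mul (2 / (Real.pi : ℂ))).sub
      (hY1.const_mul (1 / (Real.pi : ℂ)))).sub_const (1 / (Real.pi : ℂ))).const_mul (4 / Ω ^ 2)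
    -- The polar term of Y₁ cancels against √(y-1) only for y ≠ 1, so the rewriting is local.
    have hev : (fun y : ℝ => 2 / Ω * sqrtSubOne y * besselY 1 (Ω * sqrtSubOne y)) =ᶠ[𝓝 x] _ :=
      (eventually_ne_nhds hx).mono e1
    refine (h.congr_of_eventuallyEq hev).congr_deriv ?_
    simp only [Function.comp_apply]
    generalize powerSum _ _ = a
    generalize powerSum _ _ = a
    generalize powerSum _ _ = a
    field_simp
    ring

/-! ### The indefinite integrals -/

theorem isIndefiniteIntegralOn_of_hasDerivAt {I : Set ℝ} (hI : IsOpen I) (hI' : IsPreconnected I)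
    {f F : ℝ → ℂ} (hF : ∀ x ∈ I, HasDerivAt F (f x) x) : IsIndefiniteIntegralOn I f F := by
  intro G
  constructor
  · intro hG
    have hd : ∀ x ∈ I, HasDerivAt (fun x => G x - F x) 0 x := fun x hx =>
      ((hG x hx).sub (hF x hx)).congr_deriv (sub_self _)
    obtain ⟨c, hc⟩ := hI.exists_is_const_of_deriv_eq_zero hI'
      (fun x hx => (hd x hx).differentiableAt.differentiableWithinAt) (fun x hx => (hd x hx).deriv)
    exact ⟨c, fun x hx => by rw [← hc x hx]; ring⟩
  · rintro ⟨c, hc⟩ x hx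
    refine ((hF x hx).add_const c).congr_of_eventuallyEq ?_
    filter_upwards [hI.mem_nhds hx] with y hy using hc y hy

theorem hasDerivAt_heunBesselPrimitive {α β γ δ Ω : ℂ}
    (hΩ : Ω ^ 2 = 2 * α * (β + γ + 2) + 4 * δ) {B₀ B₁ H : ℂ → ℂ}
    (hB : IsBesselPairAlong Ω B₀ B₁) {x : ℝ} (hx0 : x ≠ 0) (hx1 : x ≠ 1)
    (hH : DifferentiableAt ℂ H x) (hH' : DifferentiableAt ℂ (deriv H) x)
    (hode : heunOperator α β γ δ (heunEta0 α β γ) H x = 0) :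
    HasDerivAt (heunBesselPrimitive α β γ Ω B₀ B₁ H)
      (heunBesselIntegrand α β γ Ω B₀ H x) x := by
  have hx0' : (x : ℂ) ≠ 0 := Complex.ofReal_ne_zero.2 hx0
  have hx1' : (x : ℂ) - 1 ≠ 0 := by
    rw [sub_ne_zero]
    exact_mod_cast hx1
  obtain ⟨h0, h1⟩ := hB x hx1
  have hβ : HasDerivAt (fun y : ℝ => (y : ℂ) ^ (1 + β)) ((1 + β) * (x : ℂ) ^ β) x := by
    simpa using hasDerivAt_ofReal_sub_cpow hx0 β
  have hγ : HasDerivAt (fun y : ℝ => ((y : ℂ) - 1) ^ (1 + γ)) ((1 + γ) * ((x : ℂ) - 1) ^ γ) x := by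
    simpa using hasDerivAt_ofReal_sub_cpow hx1 γ
  have hα : HasDerivAt (fun y : ℝ => Complex.exp (α * y)) (Complex.exp (α * x) * α) x := by
    simpa using (((hasDerivAt_id x).ofReal_comp).const_mul α).cexp
  -- The choice of η₀ removes the constant term, and the value of Ω² turns the coefficient of H into
  -- Ω²/4/(x-1).
  have hode' : deriv (deriv H) x = -(heunK α β γ x * deriv H x) / (x * ((x : ℂ) - 1))
      - Ω ^ 2 / 4 / ((x : ℂ) - 1) * H x := by
    rw [heunOperator, heunEta0] at hode
    rw [hΩ]
    field_simp
    linear_combination 4 * hode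
  have key := ((hβ.mul hγ).mul hα).mul
    ((h0.mul hH.hasDerivAt.comp_ofReal).sub (h1.mul hH'.hasDerivAt.comp_ofReal))
  refine key.congr_deriv ?_
  simp only [Pi.mul_apply, Pi.sub_apply]
  rw [hode', heunBesselIntegrand, ofReal_cpow_add_one hx0,
    Complex.cpow_add _ _ hx1', Complex.cpow_one]
  rw [heunK]
  -- All terms in v cancel once H'' is eliminated, so v can be an arbitrary symbol.
  generalize 2 / Ω * sqrtSubOne x * B₁ (Ω * sqrtSubOne x) = b
  field_simp
  ring

theorem mainTheorem10 (α β γ δ Ω : ℂ)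
    (hβ : ∀ n : ℕ, β ≠ -((n : ℂ) + 1))
    (hΩ : Ω ^ 2 = 2 * α * (β + γ + 2) + 4 * δ) (hΩ0 : Ω ≠ 0) :
    -- the power series is the local solution on the unit disc, with the prescribed initial values
    (IsHeunCContinuation α β γ δ (heunEta0 α β γ) (Metric.ball 0 1)
        (heunC α β γ δ (heunEta0 α β γ)) ∧
      heunC α β γ δ (heunEta0 α β γ) 0 = 1 ∧
      deriv (heunC α β γ δ (heunEta0 α β γ)) 0 =
        ((1 + γ - α) * β + γ - α + 2 * heunEta0 α β γ) / (2 * (1 + β)) ∧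
      ∀ x : ℂ, ‖x‖ < 1 → x ≠ 0 →
        deriv (deriv (heunC α β γ δ (heunEta0 α β γ))) x
          + heunP α β γ x * deriv (heunC α β γ δ (heunEta0 α β γ)) x
          + heunQ α β γ δ (heunEta0 α β γ) x * heunC α β γ δ (heunEta0 α β γ) x = 0) ∧
    -- the indefinite integrals, for `H_c` on the unit disc and for its analytic continuations
    ∀ (U : Set ℂ) (H : ℂ → ℂ), IsHeunCContinuation α β γ δ (heunEta0 α β γ) U H →
      ∀ I : Set ℝ, IsOpen I → IsPreconnected I → (0 : ℝ) ∉ I → (1 : ℝ) ∉ I →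
        (∀ x ∈ I, (x : ℂ) ∈ U) →
        IsIndefiniteIntegralOn I
          (heunBesselIntegrand α β γ Ω (besselJ 0) H)
          (heunBesselPrimitive α β γ Ω (besselJ 0) (besselJ 1) H) ∧
        IsIndefiniteIntegralOn I
          (heunBesselIntegrand α β γ Ω (besselY 0) H)
          (heunBesselPrimitive α β γ Ω (besselY 0) (besselY 1) H) := by
  have hcont := isHeunCContinuation_ball (α := α) (γ := γ) (δ := δ) (η := heunEta0 α β γ) hβ
  refine ⟨⟨hcont, ?_, ?_, ?_⟩, ?_⟩
  · exact powerSum_zero _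
  · rw [deriv_heunC hβ (by simp), powerSum_zero]
    simp [derivCoeff, heunCoeff]
  · intro x hx hx0
    refine heun_equation_of_heunOperator hx0 ?_ (heunOperator_heunC hβ hx)
    rintro rfl
    simp at hx
  · intro U H hU I hI hI' h0 h1 hIU
    have main : ∀ B₀ B₁ : ℂ → ℂ, IsBesselPairAlong Ω B₀ B₁ →
        IsIndefiniteIntegralOn I (heunBesselIntegrand α β γ Ω B₀ H)
          (heunBesselPrimitive α β γ Ω B₀ B₁ H) := fun B₀ B₁ hB =>
      isIndefiniteIntegralOn_of_hasDerivAt hI hI' fun x hx =>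
        hasDerivAt_heunBesselPrimitive hΩ hB (fun h => h0 (h ▸ hx)) (fun h => h1 (h ▸ hx))
          (hU.analyticOnNhd x (hIU x hx)).differentiableAt
          (hU.analyticOnNhd.deriv x (hIU x hx)).differentiableAt
          (hU.heunOperator_eq_zero hβ (hIU x hx))
    exact ⟨main _ _ (isBesselPairAlong_besselJ hΩ0), main _ _ (isBesselPairAlong_besselY hΩ0)⟩
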